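/- (1) Let $B$ be a CW complex of dimension at most $3$ and let $E\to B$ be a real vector bundle of rank $3$ that admits a spin structure, i.e. a lift of its structure group along the double covering $\mathrm{Spin}(3)\to\mathrm{SO}(3)\subset \mathrm{GL}(3,\mathbb{R})$. Then $E$ is trivial, i.e. isomorphic as a vector bundle to $B\times\mathbb{R}^3$. (2) For every integer $t\ge 1$, the $3$-dimensional lens space $L^{3}(t)=S^{3}/(\mathbb{Z}/t)$ is parallelizable, i.e. its tangent bundle is trivial. Here $\mathbb{Z}/t$ is the group of $t$-th roots of unity in $S^1\subset\mathbb{C}$, acting on the unit sphere $S^3\subset\mathbb{C}^2$ by $\zeta\cdot(z_0,z_1)=(\zeta z_0,\zeta z_1)$, and $L^3(t)$ has the smooth structure for which $S^3\to L^3(t)$ is a local diffeomorphism. -/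

import Mathlib

open Bundle Set
open scoped Manifold ContDiff

noncomputable section

/-! ### The group `Spin(n)` -/

/-- A Clifford algebra of a real vector space carries the canonical topology of a real vector
space: the module topology, which in finite dimension is the usual (unique Hausdorff) vector
space topology. Every submonoid of it, such as a spin group, gets the subspace topology. -/
instance CliffordAlgebra.instTopologicalSpaceReal {V : Type*} [AddCommGroup V] [Module ℝ V]
    (Q : QuadraticForm ℝ V) : TopologicalSpace (CliffordAlgebra Q) :=
  moduleTopology ℝ (CliffordAlgebra Q)

/-- The standard quadratic form `v ↦ ⟪v, v⟫ = ‖v‖ ^ 2` on `ℝⁿ`. -/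
def euclideanForm (n : ℕ) : QuadraticForm ℝ (EuclideanSpace ℝ (Fin n)) :=
  LinearMap.BilinMap.toQuadraticMap (innerₗ (EuclideanSpace ℝ (Fin n)))

/-- The topological group `Spin(n)`, inside the Clifford algebra of Euclidean space. -/
abbrev Spin (n : ℕ) : Type := spinGroup (euclideanForm n)

/-! ### Spin structures and trivial vector bundles -/

/-- A spin structure on a real vector bundle `E` of rank `n` over `B`: a lift of its structure
group along `Spin(n) → SO(n) ⊆ GL(n, ℝ)`. In detail: an atlas of local vector bundle charts
`E|U ≅ U × ℝⁿ` whose base sets cover `B`, together with a continuous `Spin(n)`-valued cocycle whose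
images under the double cover `Spin(n) → SO(n)`, `g ↦ (v ↦ g v g⁻¹)`, are the transition functions
of the atlas. -/
structure SpinStructure.{u, v} (n : ℕ) {B : Type u} [TopologicalSpace B] (E : B → Type v)
    [∀ b, AddCommGroup (E b)] [∀ b, Module ℝ (E b)]
    [TopologicalSpace (TotalSpace (EuclideanSpace ℝ (Fin n)) E)] where
  /-- the index set of the atlas -/
  index : Type u
  /-- the charts of the atlas -/
  chart : index → Trivialization (EuclideanSpace ℝ (Fin n)) (π (EuclideanSpace ℝ (Fin n)) E)
  /-- the charts are linear on the fibres -/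
  isLinear : ∀ i, (chart i).IsLinear ℝ
  /-- the charts cover the base -/
  covers : ∀ b, ∃ i, b ∈ (chart i).baseSet
  /-- the lifted transition functions; only their values on overlaps of charts matter -/
  lift : index → index → B → Spin n
  continuousOn_lift : ∀ i j,
    ContinuousOn (lift i j) ((chart i).baseSet ∩ (chart j).baseSet)
  cocycle : ∀ i j k, ∀ b ∈ (chart i).baseSet ∩ (chart j).baseSet ∩ (chart k).baseSet,
    lift i j b * lift j k b = lift i k b
  lift_spec : ∀ i j, ∀ b ∈ (chart i).baseSet ∩ (chart j).baseSet, ∀ x : E b,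
    CliffordAlgebra.ι (euclideanForm n) (chart i ⟨b, x⟩).2 =
      (lift i j b : CliffordAlgebra (euclideanForm n)) *
        CliffordAlgebra.ι (euclideanForm n) (chart j ⟨b, x⟩).2 *
        ((lift i j b)⁻¹ : Spin n)

/-- A real vector bundle with fibre `F` over `B` is trivial if it is isomorphic, as a vector
bundle, to `B × F`: there is a fibrewise linear trivialization over all of `B`. -/
def IsTrivialVectorBundle {B : Type*} [TopologicalSpace B] (F : Type*) [NormedAddCommGroup F]
    [NormedSpace ℝ F] (E : B → Type*) [∀ b, AddCommGroup (E b)] [∀ b, Module ℝ (E b)]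
    [TopologicalSpace (TotalSpace F E)] : Prop :=
  ∃ e : Trivialization F (π F E), e.IsLinear ℝ ∧ e.baseSet = univ

/-- A smooth `n`-manifold without boundary is parallelizable if its tangent bundle is a trivial
vector bundle. -/
def Parallelizable (n : ℕ) (M : Type*) [TopologicalSpace M]
    [ChartedSpace (EuclideanSpace ℝ (Fin n)) M] [IsManifold (𝓡 n) ∞ M] : Prop :=
  IsTrivialVectorBundle (EuclideanSpace ℝ (Fin n)) (fun x : M => TangentSpace (𝓡 n) x)

/-! ### Three-dimensional lens spaces -/

/-- The unit sphere `S³` of `ℂ²`. -/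
abbrev ThreeSphere : Type := Metric.sphere (0 : EuclideanSpace ℂ (Fin 2)) 1

instance ThreeSphere.factFinrank :
    Fact (Module.finrank ℝ (EuclideanSpace ℂ (Fin 2)) = 3 + 1) := ⟨by
  have h := finrank_real_of_complex (EuclideanSpace ℂ (Fin 2))
  rw [finrank_euclideanSpace_fin] at h
  exact h⟩

/-- The diagonal action of the group of complex `t`-th roots of unity on `S³`:
`ζ • (z₀, z₁) = (ζ z₀, ζ z₁)`. -/
instance ThreeSphere.rootsOfUnityAction (t : ℕ) [NeZero t] :
    MulAction (rootsOfUnity t ℂ) ThreeSphere where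
  smul ζ x := ⟨((ζ : ℂˣ) : ℂ) • (x : EuclideanSpace ℂ (Fin 2)), by
    have h1 : ‖((ζ : ℂˣ) : ℂ)‖ = 1 :=
      Complex.norm_eq_one_of_mem_rootsOfUnity ζ.2
    have h2 : ‖(x : EuclideanSpace ℂ (Fin 2))‖ = 1 := norm_eq_of_mem_sphere x
    simp [norm_smul, h1, h2]⟩
  one_smul x := Subtype.ext (one_smul ℂ (x : EuclideanSpace ℂ (Fin 2)))
  mul_smul ζ ξ x := Subtype.ext
    (mul_smul ((ζ : ℂˣ) : ℂ) ((ξ : ℂˣ) : ℂ) (x : EuclideanSpace ℂ (Fin 2)))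

theorem ThreeSphere.coe_smul (t : ℕ) [NeZero t] (ζ : rootsOfUnity t ℂ) (x : ThreeSphere) :
    ((ζ • x : ThreeSphere) : EuclideanSpace ℂ (Fin 2)) =
      ((ζ : ℂˣ) : ℂ) • (x : EuclideanSpace ℂ (Fin 2)) := rfl

instance ThreeSphere.continuousConstSMul (t : ℕ) [NeZero t] :
    ContinuousConstSMul (rootsOfUnity t ℂ) ThreeSphere where
  continuous_const_smul ζ := by
    refine Continuous.subtype_mk ?_ _
    exact continuous_subtype_val.const_smul ((ζ : ℂˣ) : ℂ)

theorem ThreeSphere.contMDiff_smul (t : ℕ) [NeZero t] (ζ : rootsOfUnity t ℂ) :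
    ContMDiff (𝓡 3) (𝓡 3) ∞ (fun x : ThreeSphere => ζ • x) := by
  have h : ContMDiff (𝓡 3) 𝓘(ℝ, EuclideanSpace ℂ (Fin 2)) ∞
      (fun x : ThreeSphere => ((ζ : ℂˣ) : ℂ) • (x : EuclideanSpace ℂ (Fin 2))) := by
    have hc : ContDiff ℝ ∞
        (fun y : EuclideanSpace ℂ (Fin 2) => ((ζ : ℂˣ) : ℂ) • y) :=
      contDiff_id.const_smul ((ζ : ℂˣ) : ℂ)
    exact hc.contMDiff.comp contMDiff_coe_sphere
  exact h.codRestrict_sphere (fun x => (ζ • x).2)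

instance ThreeSphere.isCancelSMul (t : ℕ) [NeZero t] :
    IsCancelSMul (rootsOfUnity t ℂ) ThreeSphere where
  right_cancel' ζ ξ x h := by
    have h0 : (x : EuclideanSpace ℂ (Fin 2)) ≠ 0 := by
      intro hx
      have h2 : ‖(x : EuclideanSpace ℂ (Fin 2))‖ = 1 := norm_eq_of_mem_sphere x
      simp [hx] at h2
    have h1 := congrArg (Subtype.val) h
    rw [ThreeSphere.coe_smul, ThreeSphere.coe_smul] at h1
    exact Subtype.ext (Units.ext (smul_left_injective ℂ h0 h1))

/-- The 3-dimensional `t`-torsion lens space `L³(t)`: the quotient of `S³` by the diagonal action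
of `ℤ/t`, viewed as the group of `t`-th roots of unity in the unit circle. -/
def LensSpace (t : ℕ) [NeZero t] : Type :=
  MulAction.orbitRel.Quotient (rootsOfUnity t ℂ) ThreeSphere

namespace LensSpace

variable (t : ℕ) [NeZero t]

instance : TopologicalSpace (LensSpace t) :=
  inferInstanceAs
    (TopologicalSpace (Quotient (MulAction.orbitRel (rootsOfUnity t ℂ) ThreeSphere)))

/-- The canonical projection `S³ → L³(t)`. -/
def proj (x : ThreeSphere) : LensSpace t :=
  Quotient.mk (MulAction.orbitRel (rootsOfUnity t ℂ) ThreeSphere) x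

theorem proj_surjective : Function.Surjective (proj t) := Quotient.mk_surjective

theorem proj_eq_iff {x y : ThreeSphere} :
    proj t x = proj t y ↔ ∃ ζ : rootsOfUnity t ℂ, ζ • y = x := Quotient.eq''

theorem proj_isLocalHomeomorph : IsLocalHomeomorph (proj t) :=
  (isQuotientCoveringMap_quotientMk_of_properlyDiscontinuousSMul
    (G := rootsOfUnity t ℂ) (E := ThreeSphere)).isCoveringMap.isLocalHomeomorph

theorem exists_chart (q : LensSpace t) :
    ∃ c : OpenPartialHomeomorph (LensSpace t) (EuclideanSpace ℝ (Fin 3)), q ∈ c.source ∧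
      ∃ e : OpenPartialHomeomorph ThreeSphere (LensSpace t), proj t = e ∧
        ∃ φ ∈ atlas (EuclideanSpace ℝ (Fin 3)) ThreeSphere, c = e.symm.trans φ := by
  obtain ⟨x, rfl⟩ := proj_surjective t q
  obtain ⟨e, hx, he⟩ := proj_isLocalHomeomorph t x
  refine ⟨e.symm.trans (chartAt (EuclideanSpace ℝ (Fin 3)) x), ?_, e, he,
    chartAt _ x, chart_mem_atlas _ x, rfl⟩
  have h1 : proj t x ∈ e.target := by rw [he]; exact e.map_source hx
  have h2 : e.symm (proj t x) = x := by rw [he]; exact e.left_inv hx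
  simp [h1, h2]

/-- The manifold structure of `L³(t)` for which `S³ → L³(t)` is a local diffeomorphism: its charts
are the local inverses of the projection followed by a chart of `S³`. -/
instance : ChartedSpace (EuclideanSpace ℝ (Fin 3)) (LensSpace t) where
  atlas := {c | ∃ e : OpenPartialHomeomorph ThreeSphere (LensSpace t), proj t = e ∧
    ∃ φ ∈ atlas (EuclideanSpace ℝ (Fin 3)) ThreeSphere, c = e.symm.trans φ}
  chartAt q := (exists_chart t q).choose
  mem_chart_source q := (exists_chart t q).choose_spec.1
  chart_mem_atlas q := (exists_chart t q).choose_spec.2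

/-- A local section of the projection composed with the projection is smooth, being locally the
action of a group element. -/
theorem contMDiffOn_section (e : OpenPartialHomeomorph ThreeSphere (LensSpace t))
    (he : proj t = e) :
    ContMDiffOn (𝓡 3) (𝓡 3) ∞ (fun x => e.symm (proj t x)) (proj t ⁻¹' e.target) := by
  intro x hx
  have h1 : proj t (e.symm (proj t x)) = proj t x :=
    (congrFun he _).trans (e.right_inv hx)
  obtain ⟨ζ, hζ⟩ := (proj_eq_iff t).1 h1
  have hsrc : ζ • x ∈ e.source := by rw [hζ]; exact e.map_target hx
  have hopen : IsOpen ((fun y : ThreeSphere => ζ • y) ⁻¹' e.source) :=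
    e.open_source.preimage (continuous_const_smul ζ)
  have hev : (fun y => e.symm (proj t y)) =ᶠ[nhds x] fun y => ζ • y := by
    filter_upwards [hopen.mem_nhds hsrc] with y hy
    have h2 : proj t y = e (ζ • y) := by
      rw [← he]; exact ((proj_eq_iff t).2 ⟨ζ, rfl⟩).symm
    rw [h2]; exact e.left_inv hy
  exact (((ThreeSphere.contMDiff_smul t ζ) x).congr_of_eventuallyEq hev).contMDiffWithinAt

instance : IsManifold (𝓡 3) ∞ (LensSpace t) := by
  refine isManifold_of_contDiffOn (𝓡 3) ∞ (LensSpace t) ?_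
  rintro _ _ ⟨e, he, φ, hφ, rfl⟩ ⟨e', he', φ', hφ', rfl⟩
  have h1 : ContMDiffOn (𝓡 3) (𝓡 3) ∞ φ.symm φ.target :=
    contMDiffOn_symm_of_mem_maximalAtlas (IsManifold.subset_maximalAtlas hφ)
  have h2 : ContMDiffOn (𝓡 3) (𝓡 3) ∞ φ' φ'.source :=
    contMDiffOn_of_mem_maximalAtlas (IsManifold.subset_maximalAtlas hφ')
  have h3 := h2.comp' ((contMDiffOn_section t e' he').comp' h1)
  have h4 : ContDiffOn ℝ ∞ (fun y => φ' (e'.symm (proj t (φ.symm y)))) _ := h3.contDiffOn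
  refine (h4.mono ?_).congr ?_
  · intro y hy
    simp [← he] at hy
    simp
    tauto
  · intro y hy
    simp [he]

end LensSpace

end

/-! Part (1) is obstruction theory with fibre S³. The even part of the Clifford algebra of ℝ³ is the
quaternion algebra, so `SpinThree.unitQuaternion` is a continuous homomorphism from Spin(3) to the
unit quaternions. It carries conjugation of vectors to conjugation of pure quaternions
(`SpinThree.imQuaternion_of_conj`). A spin structure thus becomes a cocycle of unit quaternions,
hence a bundle with fibre S³, and a section of that bundle untwists the transition functions and
trivializes `E` (`SpinStructure.isTrivialVectorBundle_of_section`).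

The section is built skeleton by skeleton (`exists_continuous_section`). It extends over a cell of
dimension at most 3 because a map into the unit sphere of a 4-dimensional space extends from any
closed subset of a space of smaller dimension: a smooth approximation of a Tietze extension misses
points arbitrarily near 0 (`exists_extension_unitSphere`).

Part (2) is proved directly, not through spin structures. On S³ ⊂ ℍ the fields z·i, z·j, z·k form a
tangent frame. Roots of unity act by left multiplication, which commutes with these right
multiplications (`ThreeSphere.frame_smul`), so the frame descends to the lens space. It enters as a
family of maps ℝ³ → L³(t), immersive at 0, to which `parallelizable_of_family` applies. -/

open scoped Quaternion

noncomputable section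

/-! ### The spin group `Spin(3)` and the unit quaternions -/

/-- The pure quaternion with the coordinates of a vector of `ℝ³`. -/
def imQuaternion : EuclideanSpace ℝ (Fin 3) →ₗ[ℝ] ℍ[ℝ] where
  toFun v := ⟨0, v 0, v 1, v 2⟩
  map_add' v w := by
    refine QuaternionAlgebra.ext ?_ rfl rfl rfl
    exact (add_zero (0 : ℝ)).symm
  map_smul' c v := by
    refine QuaternionAlgebra.ext ?_ rfl rfl rfl
    exact (mul_zero c).symm

theorem imQuaternion_injective : Function.Injective imQuaternion := by
  intro v w h
  ext i
  fin_cases i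
  · exact congrArg QuaternionAlgebra.imI h
  · exact congrArg QuaternionAlgebra.imJ h
  · exact congrArg QuaternionAlgebra.imK h

namespace SpinThree

/-- The Clifford algebra of Euclidean 3-space. -/
abbrev Cl : Type := CliffordAlgebra (euclideanForm 3)

/-- The image of the `a`-th standard basis vector in the Clifford algebra. -/
def gen (a : Fin 3) : Cl := CliffordAlgebra.ι (euclideanForm 3) (EuclideanSpace.single a 1)

theorem ι_eq_sum (v : EuclideanSpace ℝ (Fin 3)) :
    CliffordAlgebra.ι (euclideanForm 3) v = v 0 • gen 0 + v 1 • gen 1 + v 2 • gen 2 := by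
  have : v = v 0 • EuclideanSpace.single 0 1 + v 1 • EuclideanSpace.single 1 1
      + v 2 • EuclideanSpace.single 2 (1 : ℝ) := by
    ext i; fin_cases i <;> simp
  conv_lhs => rw [this]
  simp [gen]

theorem gen_mul_self (a : Fin 3) : gen a * gen a = 1 := by
  have h : euclideanForm 3 (EuclideanSpace.single a 1) = 1 := by simp [euclideanForm]
  rw [gen, CliffordAlgebra.ι_sq_scalar, h, map_one]

theorem gen_mul_gen {a b : Fin 3} (h : a ≠ b) : gen a * gen b = - (gen b * gen a) := by
  have h : QuadraticMap.polar (euclideanForm 3) (EuclideanSpace.single a 1)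
      (EuclideanSpace.single b 1) = 0 := by
    simp [euclideanForm, QuadraticMap.polar, inner_add_right,
      EuclideanSpace.inner_single_left, h, h.symm]
  rw [eq_neg_iff_add_eq_zero, gen, gen, CliffordAlgebra.ι_mul_ι_add_swap, h, map_zero]

theorem star_gen (a : Fin 3) : star (gen a) = - gen a := by
  simp [gen, CliffordAlgebra.star_def]

/-- The even products of generators satisfy the relations of the quaternion units. -/
def quaternionBasis : QuaternionAlgebra.Basis Cl (-1 : ℝ) 0 (-1) where
  i := gen 2 * gen 1
  j := gen 0 * gen 2
  k := gen 1 * gen 0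
  i_mul_i := by
    rw [mul_assoc, ← mul_assoc (gen 1), gen_mul_gen (show (1 : Fin 3) ≠ 2 by decide)]
    simp [mul_assoc, gen_mul_self]
  j_mul_j := by
    rw [mul_assoc, ← mul_assoc (gen 2), gen_mul_gen (show (2 : Fin 3) ≠ 0 by decide)]
    simp [mul_assoc, gen_mul_self]
  i_mul_j := by
    rw [gen_mul_gen (show (2 : Fin 3) ≠ 1 by decide), gen_mul_gen (show (0 : Fin 3) ≠ 2 by decide),
      neg_mul_neg, mul_assoc, ← mul_assoc (gen 2), gen_mul_self, one_mul]
  j_mul_i := by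
    rw [mul_assoc, ← mul_assoc (gen 2), gen_mul_self, one_mul,
      gen_mul_gen (show (0 : Fin 3) ≠ 1 by decide)]
    simp

/-- The embedding of the quaternions onto the even part of the Clifford algebra. -/
def ofQuaternion : ℍ[ℝ] →ₐ[ℝ] Cl := quaternionBasis.liftHom

theorem ofQuaternion_apply (q : ℍ[ℝ]) :
    ofQuaternion q = algebraMap ℝ _ q.re + q.imI • (gen 2 * gen 1) + q.imJ • (gen 0 * gen 2)
      + q.imK • (gen 1 * gen 0) := rfl

theorem ofQuaternion_injective : Function.Injective ofQuaternion :=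
  (ofQuaternion : ℍ[ℝ] →+* Cl).injective

theorem star_ofQuaternion (q : ℍ[ℝ]) : star (ofQuaternion q) = ofQuaternion (star q) := by
  simp only [ofQuaternion_apply, star_add, CliffordAlgebra.star_algebraMap,
    CliffordAlgebra.star_smul, star_mul, star_gen, Quaternion.re_star, Quaternion.imI_star,
    Quaternion.imJ_star, Quaternion.imK_star, neg_mul_neg,
    gen_mul_gen (show (1 : Fin 3) ≠ 2 by decide), gen_mul_gen (show (2 : Fin 3) ≠ 0 by decide),
    gen_mul_gen (show (0 : Fin 3) ≠ 1 by decide), smul_neg, neg_smul]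

/-- The volume element of the Clifford algebra. -/
def vol : Cl := gen 0 * gen 1 * gen 2

theorem anticommuting_triple {R : Type*} [Ring R] {a b c : R} (hab : a * b = -(b * a))
    (hca : c * a = -(a * c)) (hcb : c * b = -(b * c)) (ha : a * a = 1) (hb : b * b = 1)
    (hc : c * c = 1) :
    (a * b * c * a = a * (a * b * c) ∧ a * b * c * b = b * (a * b * c) ∧
      a * b * c * c = c * (a * b * c)) ∧ a * b * c * (a * b * c) = -1 ∧
    a * b * c * (c * b) = a ∧ a * b * c * (a * c) = b ∧ a * b * c * (b * a) = c := by
  have hba : b * a = -(a * b) := by rw [hab, neg_neg]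
  -- The primed rules act inside right-associated words. Together the rules sort any word into the
  -- order a, b, c and cancel squares.
  have hba' (x : R) : b * (a * x) = -(a * (b * x)) := by
    rw [← mul_assoc, hba, neg_mul, mul_assoc]
  have hca' (x : R) : c * (a * x) = -(a * (c * x)) := by
    rw [← mul_assoc, hca, neg_mul, mul_assoc]
  have hcb' (x : R) : c * (b * x) = -(b * (c * x)) := by
    rw [← mul_assoc, hcb, neg_mul, mul_assoc]
  have ha' (x : R) : a * (a * x) = x := by rw [← mul_assoc, ha, one_mul]
  have hb' (x : R) : b * (b * x) = x := by rw [← mul_assoc, hb, one_mul]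
  simp only [mul_assoc, hba, hca, hcb, ha, hb, hc, hba', hca', hcb', ha', hb', mul_neg, neg_neg,
    mul_one, and_self]

theorem vol_relations :
    (vol * gen 0 = gen 0 * vol ∧ vol * gen 1 = gen 1 * vol ∧ vol * gen 2 = gen 2 * vol) ∧
      vol * vol = -1 ∧ vol * (gen 2 * gen 1) = gen 0 ∧ vol * (gen 0 * gen 2) = gen 1 ∧
      vol * (gen 1 * gen 0) = gen 2 :=
  anticommuting_triple (gen_mul_gen (show (0 : Fin 3) ≠ 1 by decide))
  (gen_mul_gen (show (2 : Fin 3) ≠ 0 by decide)) (gen_mul_gen (show (2 : Fin 3) ≠ 1 by decide))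
  (gen_mul_self 0) (gen_mul_self 1) (gen_mul_self 2)

theorem vol_mul_gen (a : Fin 3) : vol * gen a = gen a * vol := by
  fin_cases a
  exacts [vol_relations.1.1, vol_relations.1.2.1, vol_relations.1.2.2]

theorem vol_mul_vol : vol * vol = -1 := vol_relations.2.1

theorem vol_mul_ofQuaternion (q : ℍ[ℝ]) : vol * ofQuaternion q = ofQuaternion q * vol := by
  have h (a b : Fin 3) : vol * (gen a * gen b) = gen a * gen b * vol := by
    rw [← mul_assoc, vol_mul_gen, mul_assoc, vol_mul_gen, mul_assoc]
  simp only [ofQuaternion_apply, mul_add, add_mul, mul_smul_comm, smul_mul_assoc, h,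
    Algebra.commutes]

/-- In dimension 3 the volume element is central and multiplication by it exchanges bivectors and
vectors. This reduces conjugation of vectors to conjugation of pure quaternions. -/
theorem ι_eq_vol_mul (v : EuclideanSpace ℝ (Fin 3)) :
    CliffordAlgebra.ι (euclideanForm 3) v = vol * ofQuaternion (imQuaternion v) := by
  obtain ⟨-, -, h0, h1, h2⟩ := vol_relations
  have hre : (imQuaternion v).re = 0 := rfl
  rw [ι_eq_sum, ofQuaternion_apply, hre, map_zero, zero_add, mul_add, mul_add, mul_smul_comm,
    mul_smul_comm, mul_smul_comm, h0, h1, h2]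
  rfl

/-- By centrality of `vol` and `vol * vol = -1`, a product of two vectors is minus the product of
the corresponding pure quaternions. -/
theorem mem_range_ofQuaternion {x : Cl} (hx : x ∈ CliffordAlgebra.even (euclideanForm 3)) :
    x ∈ ofQuaternion.range := by
  induction x, hx using CliffordAlgebra.even_induction with
  | algebraMap r => exact ⟨algebraMap ℝ _ r, ofQuaternion.commutes r⟩
  | add x y hx hy ihx ihy => exact add_mem ihx ihy
  | ι_mul_ι_mul m₁ m₂ x hx ih =>
    refine mul_mem ?_ ih
    refine ⟨- (imQuaternion m₁ * imQuaternion m₂), ?_⟩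
    change ofQuaternion _ = _
    rw [ι_eq_vol_mul, ι_eq_vol_mul, mul_assoc, ← mul_assoc (ofQuaternion _) vol,
      ← vol_mul_ofQuaternion, mul_assoc, ← mul_assoc vol, vol_mul_vol, map_neg, map_mul]
    simp

/-- A linear retraction of the Clifford algebra onto the quaternions. -/
def toQuaternion : Cl →ₗ[ℝ] ℍ[ℝ] :=
  (ofQuaternion.toLinearMap.exists_leftInverse_of_injective
    (LinearMap.ker_eq_bot.2 ofQuaternion_injective)).choose

theorem toQuaternion_ofQuaternion (q : ℍ[ℝ]) : toQuaternion (ofQuaternion q) = q :=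
  LinearMap.congr_fun (ofQuaternion.toLinearMap.exists_leftInverse_of_injective
    (LinearMap.ker_eq_bot.2 ofQuaternion_injective)).choose_spec q

instance : IsModuleTopology ℝ Cl := ⟨rfl⟩

/-- The module topology makes every such linear map continuous, so the retraction may be an
arbitrary choice. -/
theorem continuous_toQuaternion : Continuous toQuaternion :=
  IsModuleTopology.continuous_of_linearMap toQuaternion

theorem ofQuaternion_toQuaternion (g : Spin 3) : ofQuaternion (toQuaternion g) = g := by
  obtain ⟨q, hq⟩ := mem_range_ofQuaternion (spinGroup.mem_even g.2)
  change ofQuaternion q = g at hq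
  rw [← hq, toQuaternion_ofQuaternion]

theorem toQuaternion_mul (g h : Spin 3) :
    toQuaternion (g * h : Spin 3) = toQuaternion g * toQuaternion h := by
  apply ofQuaternion_injective
  rw [map_mul, ofQuaternion_toQuaternion, ofQuaternion_toQuaternion, ofQuaternion_toQuaternion]
  rfl

theorem star_toQuaternion (g : Spin 3) :
    toQuaternion (g⁻¹ : Spin 3) = star (toQuaternion g) := by
  apply ofQuaternion_injective
  rw [ofQuaternion_toQuaternion, ← star_ofQuaternion, ofQuaternion_toQuaternion]
  rfl

theorem norm_toQuaternion (g : Spin 3) : ‖toQuaternion g‖ = 1 := by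
  have h : toQuaternion g * star (toQuaternion g) = 1 := by
    rw [← star_toQuaternion, ← toQuaternion_mul, mul_inv_cancel]
    have := toQuaternion_ofQuaternion 1
    rwa [map_one] at this
  rw [Quaternion.self_mul_star] at h
  have h2 : Quaternion.normSq (toQuaternion g) = 1 := Quaternion.coe_injective h
  rw [Quaternion.normSq_eq_norm_mul_self] at h2
  nlinarith [norm_nonneg (toQuaternion g)]

/-- The unit quaternion corresponding to an element of `Spin(3)`. -/
def unitQuaternion (g : Spin 3) : Metric.sphere (0 : ℍ[ℝ]) 1 :=
  ⟨toQuaternion g, by simpa using norm_toQuaternion g⟩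

theorem continuous_unitQuaternion : Continuous unitQuaternion :=
  (continuous_toQuaternion.comp continuous_subtype_val).subtype_mk _

theorem unitQuaternion_mul (g h : Spin 3) :
    unitQuaternion (g * h) = unitQuaternion g * unitQuaternion h :=
  Subtype.ext (toQuaternion_mul g h)

theorem imQuaternion_of_conj {g : Spin 3} {v w : EuclideanSpace ℝ (Fin 3)}
    (h : CliffordAlgebra.ι (euclideanForm 3) v =
      (g : Cl) * CliffordAlgebra.ι (euclideanForm 3) w * (g⁻¹ : Spin 3)) :
    imQuaternion v =
      unitQuaternion g * imQuaternion w * star (unitQuaternion g : ℍ[ℝ]) := by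
  apply ofQuaternion_injective
  -- `vol` can be cancelled because its square is -1.
  have hv : Function.Injective (fun x : Cl => vol * x) := by
    intro x y hxy
    have := congrArg (fun z => vol * z) hxy
    simpa [← mul_assoc, vol_mul_vol] using this
  apply hv
  change vol * _ = vol * _
  have hg : ofQuaternion (unitQuaternion g : ℍ[ℝ]) = g := ofQuaternion_toQuaternion g
  rw [← ι_eq_vol_mul, h, map_mul, map_mul, ← star_ofQuaternion, ι_eq_vol_mul,
    ← mul_assoc (g : Cl), ← mul_assoc vol (_ * _), ← mul_assoc vol (ofQuaternion _),
    vol_mul_ofQuaternion, hg]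
  rfl

end SpinThree

/-! ### Extending maps into spheres -/

/-- A continuous map from a closed subset of `E` to the unit sphere of `F` extends to `E`
if `dim E < dim F`. -/
theorem exists_extension_unitSphere {E F : Type*} [NormedAddCommGroup E] [NormedSpace ℝ E]
    [FiniteDimensional ℝ E] [NormedAddCommGroup F] [NormedSpace ℝ F] [FiniteDimensional ℝ F]
    (hEF : Module.finrank ℝ E < Module.finrank ℝ F) {A : Set E} (hA : IsClosed A)
    {f : E → F} (hf : ContinuousOn f A) (hf1 : ∀ x ∈ A, ‖f x‖ = 1) :
    ∃ g : E → F, Continuous g ∧ (∀ x, ‖g x‖ = 1) ∧ EqOn g f A := by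
  -- Tietze extension into the vector space `F`; it may vanish away from `A`.
  obtain ⟨h, hh⟩ := ContinuousMap.exists_restrict_eq (Y := F) hA ⟨A.domRestrict f, hf.domRestrict⟩
  have hhf : ∀ x ∈ A, h x = f x := fun x hx => DFunLike.congr_fun hh (⟨x, hx⟩ : A)
  obtain ⟨p, hph, hp⟩ : ∃ p : E → F, (∀ x, dist (p x) (h x) < 1 / 8) ∧ ContDiff ℝ ∞ p := by
    obtain ⟨p, hp⟩ := exists_contMDiffMap_forall_mem_convex_of_local_const (n := ⊤) 𝓘(ℝ, E)
      (t := fun x => Metric.ball (h x) (1 / 8)) (fun x => convex_ball _ _) fun x => ⟨h x, by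
        filter_upwards [h.continuous.continuousAt (Metric.ball_mem_nhds (h x)
          (show (0 : ℝ) < 1 / 8 by norm_num))] with y hy
        exact Metric.mem_ball_comm.1 hy⟩
    exact ⟨p, hp, p.contMDiff.contDiff⟩
  -- The range of a smooth map into a space of larger dimension has dense complement, so a small
  -- translate of `p` avoids 0.
  obtain ⟨c, hc, hc0⟩ := ((hp.of_le (by norm_num)).dense_compl_range_of_finrank_lt_finrank
    hEF).exists_dist_lt (0 : F) (show (0 : ℝ) < 1 / 8 by norm_num)
  rw [dist_zero_left] at hc0
  let q : E → F := fun x => p x - c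
  have hq0 (x : E) : q x ≠ 0 := fun hx => hc ⟨x, sub_eq_zero.1 hx⟩
  have hqh (x : E) : ‖q x - h x‖ < 1 / 4 := by
    have h1 := hph x
    rw [dist_eq_norm] at h1
    calc ‖q x - h x‖ = ‖(p x - h x) - c‖ := by simp only [q]; congr 1; abel
      _ ≤ ‖p x - h x‖ + ‖c‖ := norm_sub_le _ _
      _ < 1 / 4 := by linarith
  -- The weight is 1 where ‖h‖ ≤ 3/4, so that G = q ≠ 0 there, and 0 where ‖h‖ ≥ 1, so that G = h on
  -- `A`. Where ‖h‖ ≥ 3/4, G stays within 1/4 of h and cannot vanish.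
  let l : E → ℝ := fun x => max 0 (min 1 (4 * (1 - ‖h x‖)))
  let G : E → F := fun x => h x + l x • (q x - h x)
  have hl0 (x : E) : 0 ≤ l x := le_max_left _ _
  have hl1 (x : E) : l x ≤ 1 := max_le zero_le_one (min_le_left _ _)
  have hqc : Continuous q := hp.continuous.sub continuous_const
  have hG : Continuous G := by fun_prop
  have hG0 (x : E) : G x ≠ 0 := by
    rcases lt_or_ge ‖h x‖ (3 / 4) with hx | hx
    · have : l x = 1 := by
        simp only [l]
        rw [min_eq_left (by linarith), max_eq_right zero_le_one]
      simpa [G, this] using hq0 x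
    · intro h0
      have h1 : h x = - (l x • (q x - h x)) := eq_neg_of_add_eq_zero_left h0
      have h2 : ‖h x‖ ≤ 1 * ‖q x - h x‖ := by
        rw [h1, norm_neg, norm_smul, Real.norm_of_nonneg (hl0 x), ← h1]
        gcongr
        exact hl1 x
      linarith [hqh x]
  refine ⟨fun x => ‖G x‖⁻¹ • G x, (hG.norm.inv₀ fun x => norm_ne_zero_iff.2 (hG0 x)).smul hG,
    fun x => norm_smul_inv_norm (𝕜 := ℝ) (hG0 x), fun x hx => ?_⟩
  have hx1 : ‖h x‖ = 1 := by rw [hhf x hx, hf1 x hx]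
  have : l x = 0 := by simp [l, hx1]
  simp [G, this, hhf x hx, hf1 x hx]

/-- A space `F` is an absolute extensor for `X` if continuous maps to `F` extend from closed
subsets of `X`. -/
def IsExtensorFor (F X : Type*) [TopologicalSpace F] [TopologicalSpace X] : Prop :=
  ∀ (A : Set X) (f : X → F), IsClosed A → ContinuousOn f A → ∃ g : X → F, Continuous g ∧ EqOn g f A

/-- Since k < 4 = dim ℍ, sphere-valued maps extend; this plays the role of the vanishing of π₀, π₁
and π₂ of S³. -/
theorem isExtensorFor_unitQuaternion {k : ℕ} (hk : k ≤ 3) :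
    IsExtensorFor (Metric.sphere (0 : ℍ[ℝ]) 1) (Fin k → ℝ) := by
  intro A f hA hf
  have hdim : Module.finrank ℝ (Fin k → ℝ) < Module.finrank ℝ ℍ[ℝ] := by
    rw [Module.finrank_fin_fun, Quaternion.finrank_eq_four]
    omega
  obtain ⟨g, hg, hg1, hgf⟩ := exists_extension_unitSphere hdim hA
    (continuous_subtype_val.comp_continuousOn hf) fun x _ => norm_eq_of_mem_sphere (f x)
  exact ⟨fun x => ⟨g x, mem_sphere_zero_iff_norm.2 (hg1 x)⟩, hg.subtype_mk _,
    fun x hx => Subtype.ext (hgf hx)⟩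

/-! ### Extending lifts to fiber bundles -/

section Lift

variable {B F X : Type*} [TopologicalSpace B] [TopologicalSpace F] [TopologicalSpace X]
  {E : B → Type*} [TopologicalSpace (TotalSpace F E)] {Φ : X → B}

/-- Lifts to a fiber bundle extend over a closed set whose image lies in a single chart. -/
theorem exists_extension_lift_of_mapsTo_baseSet (hF : IsExtensorFor F X)
    (e : Trivialization F (π F E)) {A C : Set X} (hA : IsClosed A) (hC : IsClosed C)
    (hΦ : ContinuousOn Φ C) (hCe : MapsTo Φ C e.baseSet) {f : X → TotalSpace F E}
    (hf : ContinuousOn f A) (hfΦ : ∀ x ∈ A, (f x).proj = Φ x) :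
    ∃ g : X → TotalSpace F E, ContinuousOn g (A ∪ C) ∧ (∀ x ∈ A ∪ C, (g x).proj = Φ x) ∧
      EqOn g f A := by
  classical
  have hmem : ∀ x ∈ A ∩ C, f x ∈ e.source := fun x hx => by
    rw [e.mem_source]
    exact (hfΦ x hx.1).symm ▸ hCe hx.2
  -- Inside a chart a lift of `Φ` amounts to a map into the fibre.
  obtain ⟨h, hh, hhf⟩ := hF (A ∩ C) (fun x => (e (f x)).2) (hA.inter hC)
    (continuous_snd.comp_continuousOn
      (e.continuousOn.comp (hf.mono inter_subset_left) hmem))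
  let g₁ : X → TotalSpace F E := fun x => e.toOpenPartialHomeomorph.symm (Φ x, h x)
  have htgt : ∀ x ∈ C, (Φ x, h x) ∈ e.target := fun x hx => e.mem_target.2 (hCe hx)
  have hg₁ : ContinuousOn g₁ C :=
    e.toOpenPartialHomeomorph.continuousOn_symm.comp (hΦ.prodMk hh.continuousOn)
      fun x hx => htgt x hx
  have hg₁f : ∀ x ∈ A ∩ C, g₁ x = f x := fun x hx => by
    have h1 : (Φ x, h x) = e (f x) :=
      Prod.ext (by rw [e.coe_fst (hmem x hx), hfΦ x hx.1]) (hhf hx)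
    simp only [g₁, h1]
    exact e.left_inv (hmem x hx)
  have hgC : EqOn (A.piecewise f g₁) g₁ C := fun x hx => by
    by_cases hxA : x ∈ A
    · rw [piecewise_eq_of_mem _ _ _ hxA, hg₁f x ⟨hxA, hx⟩]
    · rw [piecewise_eq_of_notMem _ _ _ hxA]
  have hgA : EqOn (A.piecewise f g₁) f A := piecewise_eqOn _ _ _
  refine ⟨A.piecewise f g₁, (hf.congr hgA).union_of_isClosed (hg₁.congr hgC) hA hC, ?_, hgA⟩
  rintro x (hx | hx)
  · rw [hgA hx, hfΦ x hx]
  · rw [hgC hx]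
    exact e.proj_symm_apply (htgt x hx)

/-- Lifts to a fiber bundle extend over a compact set. -/
theorem exists_extension_lift [RegularSpace X] [∀ b, TopologicalSpace (E b)]
    [FiberBundle F E] (hF : IsExtensorFor F X) {A K : Set X} (hA : IsClosed A) (hK : IsCompact K)
    (hKc : IsClosed K) (hΦ : ContinuousOn Φ K) {f : X → TotalSpace F E}
    (hf : ContinuousOn f A) (hfΦ : ∀ x ∈ A, (f x).proj = Φ x) :
    ∃ g : X → TotalSpace F E, ContinuousOn g (A ∪ K) ∧ (∀ x ∈ A ∪ K, (g x).proj = Φ x) ∧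
      EqOn g f A := by
  -- Quantifying over all `A` and `f` makes the property stable under unions, as compactness
  -- induction requires. The intersection with `K` is there because `Φ` is continuous only on `K`.
  have key : ∃ C : Set X, IsClosed C ∧ K ⊆ C ∧ ∀ (A : Set X) (f : X → TotalSpace F E),
      IsClosed A → ContinuousOn f A → (∀ x ∈ A, (f x).proj = Φ x) →
      ∃ g : X → TotalSpace F E, ContinuousOn g (A ∪ C ∩ K) ∧
        (∀ x ∈ A ∪ C ∩ K, (g x).proj = Φ x) ∧ EqOn g f A := by
    refine hK.induction_on (p := fun S => ∃ C : Set X, IsClosed C ∧ S ⊆ C ∧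
      ∀ (A : Set X) (f : X → TotalSpace F E),
      IsClosed A → ContinuousOn f A → (∀ x ∈ A, (f x).proj = Φ x) →
      ∃ g : X → TotalSpace F E, ContinuousOn g (A ∪ C ∩ K) ∧
        (∀ x ∈ A ∪ C ∩ K, (g x).proj = Φ x) ∧ EqOn g f A) ?_ ?_ ?_ ?_
    · exact ⟨∅, isClosed_empty, empty_subset _, fun A f _ hf hfΦ =>
        ⟨f, by simpa using hf, by simpa using hfΦ, fun _ _ => rfl⟩⟩
    · rintro S T hST ⟨C, hC, hTC, H⟩
      exact ⟨C, hC, hST.trans hTC, H⟩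
    · rintro S T ⟨C, hC, hSC, H⟩ ⟨D, hD, hTD, H'⟩
      refine ⟨C ∪ D, hC.union hD, union_subset_union hSC hTD, fun A f hA hf hfΦ => ?_⟩
      obtain ⟨g, hg, hgΦ, hgf⟩ := H A f hA hf hfΦ
      obtain ⟨g', hg', hgΦ', hgf'⟩ := H' _ g (hA.union (hC.inter hKc)) hg hgΦ
      rw [union_assoc, ← union_inter_distrib_right] at hg' hgΦ'
      exact ⟨g', hg', hgΦ', fun x hx => (hgf' (Or.inl hx)).trans (hgf hx)⟩
    · intro x hx
      let e := trivializationAt F E (Φ x)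
      have h1 : Φ ⁻¹' e.baseSet ∈ nhdsWithin x K :=
        (hΦ x hx).preimage_mem_nhdsWithin
          (e.open_baseSet.mem_nhds (mem_baseSet_trivializationAt F E (Φ x)))
      obtain ⟨U, hU, hUK⟩ := mem_nhdsWithin_iff_exists_mem_nhds_inter.1 h1
      obtain ⟨C, hC, hCc, hCU⟩ : ∃ C ∈ nhds x, IsClosed C ∧ C ∩ K ⊆ U := 
        let ⟨C, hC, hCc, hCU⟩ := exists_mem_nhds_isClosed_subset hU
        ⟨C, hC, hCc, inter_subset_left.trans hCU⟩
      refine ⟨C, mem_nhdsWithin_of_mem_nhds hC, C, hCc, Subset.rfl, fun A f hA hf hfΦ => ?_⟩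
      exact exists_extension_lift_of_mapsTo_baseSet hF e hA (hCc.inter hKc)
        (hΦ.mono inter_subset_right) (fun y hy => hUK ⟨hCU hy, hy.2⟩) hf hfΦ
  obtain ⟨C, hC, hKC, H⟩ := key
  simpa [inter_eq_right.2 hKC] using H A f hA hf hfΦ

end Lift

/-! ### Sections of fiber bundles over CW complexes -/

section CW

open Topology Metric

variable {B F : Type*} [TopologicalSpace B] [T2Space B] [CWComplex (univ : Set B)]
  [TopologicalSpace F] {E : B → Type*} [TopologicalSpace (TotalSpace F E)]

/-- A function on a skeleton is continuous if it is continuous on each closed cell. -/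
theorem continuousOn_skeletonLT {Y : Type*} [TopologicalSpace Y] {n : ℕ} {s : B → Y}
    (hs : ∀ m < n, ∀ j : RelCWComplex.cell (univ : Set B) m,
      ContinuousOn (s ∘ RelCWComplex.map m j) (closedBall 0 1)) :
    ContinuousOn s (RelCWComplex.skeletonLT (univ : Set B) n) := by
  refine continuousOn_iff_isClosed.2 fun t ht =>
    ⟨s ⁻¹' t ∩ RelCWComplex.skeletonLT (univ : Set B) n, ?_, by rw [inter_assoc, inter_self]⟩
  refine CWComplex.isClosed_of_isClosed_inter_openCell_or_isClosed_inter_closedCell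
    (C := (univ : Set B)) (subset_univ _) fun m _ j => ?_
  rcases lt_or_ge m n with hmn | hmn
  · right
    have hsub : RelCWComplex.closedCell m j ⊆ RelCWComplex.skeletonLT (univ : Set B) n :=
      (RelCWComplex.closedCell_subset_skeletonLT m j).trans
        (RelCWComplex.skeletonLT_mono (by exact_mod_cast hmn))
    have heq : s ⁻¹' t ∩ RelCWComplex.skeletonLT (univ : Set B) n ∩ RelCWComplex.closedCell m j =
        RelCWComplex.map m j '' (closedBall 0 1 ∩ (s ∘ RelCWComplex.map m j) ⁻¹' t) := by
      rw [inter_assoc, inter_eq_right.2 hsub]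
      ext x
      constructor
      · rintro ⟨hx, y, hy, rfl⟩
        exact ⟨y, ⟨hy, hx⟩, rfl⟩
      · rintro ⟨y, ⟨hy, hx⟩, rfl⟩
        exact ⟨hx, y, hy, rfl⟩
    rw [heq]
    have hcl : IsClosed (closedBall (0 : Fin m → ℝ) 1 ∩ (s ∘ RelCWComplex.map m j) ⁻¹' t) :=
      (hs m hmn j).preimage_isClosed_of_isClosed isClosed_closedBall ht
    exact (((isCompact_closedBall _ _).of_isClosed_subset hcl
      inter_subset_left).image_of_continuousOn
      ((RelCWComplex.continuousOn m j).mono inter_subset_left)).isClosed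
  · left
    have := RelCWComplex.disjoint_skeletonLT_openCell (C := (univ : Set B)) (n := n) (j := j)
      (by exact_mod_cast hmn)
    rw [inter_assoc, this.inter_eq, inter_empty]
    exact isClosed_empty

/-- If the fiber is an extensor for the cells, then a fiber bundle over a CW complex has a section
over each finite skeleton. -/
theorem exists_section_skeletonLT [Nonempty F] [∀ b, TopologicalSpace (E b)] [FiberBundle F E]
    (n : ℕ) (hF : ∀ k < n, IsExtensorFor F (Fin k → ℝ)) :
    ∃ s : B → TotalSpace F E, ContinuousOn s (RelCWComplex.skeletonLT (univ : Set B) n) ∧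
      ∀ b, (s b).proj = b := by
  classical
  induction n with
  | zero =>
    -- `skeletonLT 0` is empty, so any set-theoretic section will do.
    obtain ⟨v⟩ := ‹Nonempty F›
    choose s hs using fun b : B =>
      (trivializationAt F E b).proj_surjOn_baseSet (mem_baseSet_trivializationAt F E b)
    refine ⟨s, ?_, fun b => (hs b).2⟩
    simp [CWComplex.skeletonLT_zero_eq_empty]
  | succ n ih =>
    obtain ⟨s, hs, hsp⟩ := ih fun k hk => hF k (hk.trans n.lt_succ_self)
    let S : Set B := (RelCWComplex.skeletonLT (univ : Set B) n : RelCWComplex.Subcomplex univ)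
    have hfr (j : RelCWComplex.cell (univ : Set B) n) :
        MapsTo (RelCWComplex.map n j) (sphere 0 1) S := fun x hx =>
      RelCWComplex.cellFrontier_subset_skeletonLT n j ⟨x, hx, rfl⟩
    -- A lift of the characteristic map with prescribed boundary values replaces a section of the
    -- pulled-back bundle.
    have hext (j : RelCWComplex.cell (univ : Set B) n) : ∃ g : (Fin n → ℝ) → TotalSpace F E,
        ContinuousOn g (closedBall 0 1) ∧
        (∀ x ∈ closedBall 0 1, (g x).proj = RelCWComplex.map n j x) ∧
        EqOn g (s ∘ RelCWComplex.map n j) (sphere 0 1) := by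
      have h := exists_extension_lift (hF n n.lt_succ_self) (isClosed_sphere (x := 0) (ε := 1))
        (isCompact_closedBall 0 1) isClosed_closedBall (RelCWComplex.continuousOn n j)
        (hs.comp ((RelCWComplex.continuousOn n j).mono sphere_subset_closedBall) (hfr j))
        (fun x _ => hsp _)
      rwa [union_eq_right.2 sphere_subset_closedBall] at h
    choose g hg hgp hgs using hext
    let s' : B → TotalSpace F E := fun b => if b ∈ S then s b else
      if h : ∃ j : RelCWComplex.cell (univ : Set B) n, b ∈ RelCWComplex.openCell n j then
        g h.choose ((RelCWComplex.map n h.choose).symm b) else s b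
    have hs'S : EqOn s' s S := fun b hb => if_pos hb
    have hsymm (j : RelCWComplex.cell (univ : Set B) n) (x : Fin n → ℝ) (hx : x ∈ ball 0 1) :
        (RelCWComplex.map n j).symm (RelCWComplex.map n j x) = x :=
      (RelCWComplex.map n j).left_inv (by rwa [RelCWComplex.source_eq])
    have hs'g (j : RelCWComplex.cell (univ : Set B) n) :
        EqOn (s' ∘ RelCWComplex.map n j) (g j) (closedBall 0 1) := by
      intro x hx
      rcases (mem_closedBall.1 hx).lt_or_eq with hx1 | hx1
      · have hmem : RelCWComplex.map n j x ∈ RelCWComplex.openCell n j := ⟨x, hx1, rfl⟩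
        have hnS : RelCWComplex.map n j x ∉ S := fun h =>
          (RelCWComplex.disjoint_skeletonLT_openCell (C := (univ : Set B)) (n := n) (j := j)
            le_rfl).notMem_of_mem_left h hmem
        have hex : ∃ j' : RelCWComplex.cell (univ : Set B) n,
            RelCWComplex.map n j x ∈ RelCWComplex.openCell n j' := ⟨j, hmem⟩
        -- Distinct open cells are disjoint.
        have hj : hex.choose = j := by
          have := RelCWComplex.eq_of_not_disjoint_openCell
            (not_disjoint_iff.2 ⟨_, hex.choose_spec, hmem⟩)
          simpa using this
        simp only [s', Function.comp_apply, if_neg hnS, dif_pos hex, hj]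
        rw [hsymm j x hx1]
      · exact (hs'S (hfr j hx1)).trans (hgs j hx1).symm
    refine ⟨s', ?_, fun b => ?_⟩
    · refine continuousOn_skeletonLT fun m hm j => ?_
      rcases (Nat.lt_succ_iff.1 hm).lt_or_eq with hmn | rfl
      · have hmaps : MapsTo (RelCWComplex.map m j) (closedBall 0 1) S := fun x hx =>
          RelCWComplex.skeletonLT_mono (by exact_mod_cast hmn)
            (RelCWComplex.closedCell_subset_skeletonLT m j ⟨x, hx, rfl⟩)
        exact (hs.comp (RelCWComplex.continuousOn m j) hmaps).congr fun x hx => hs'S (hmaps hx)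
      · exact (hg j).congr (hs'g j)
    · by_cases hb : b ∈ S
      · rw [hs'S hb, hsp]
      · by_cases h : ∃ j : RelCWComplex.cell (univ : Set B) n, b ∈ RelCWComplex.openCell n j
        · obtain ⟨j, x, hx, rfl⟩ := h
          have := hs'g j (ball_subset_closedBall hx)
          rw [Function.comp_apply] at this
          rw [this, hgp j x (ball_subset_closedBall hx)]
        · simp only [s', if_neg hb, dif_neg h, hsp]

/-- A fiber bundle over a CW complex of dimension less than `n` has a section if the fiber is an
extensor for cubes of dimension less than `n`. -/
theorem exists_continuous_section [Nonempty F] [∀ b, TopologicalSpace (E b)] [FiberBundle F E]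
    (n : ℕ) (hn : ∀ k : ℕ, n ≤ k → IsEmpty (RelCWComplex.cell (univ : Set B) k))
    (hF : ∀ k < n, IsExtensorFor F (Fin k → ℝ)) :
    ∃ s : B → TotalSpace F E, Continuous s ∧ ∀ b, (s b).proj = b := by
  obtain ⟨s, hs, hsp⟩ := exists_section_skeletonLT (B := B) (E := E) n hF
  have huniv : (RelCWComplex.skeletonLT (univ : Set B) n : Set B) = univ := by
    refine eq_univ_of_forall fun b => ?_
    have hb : b ∈ ⋃ (m : ℕ) (j : RelCWComplex.cell (univ : Set B) m),
        RelCWComplex.closedCell m j := by rw [CWComplex.union]; trivial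
    obtain ⟨m, j, hj⟩ := mem_iUnion₂.1 hb
    have hm : m < n := by
      by_contra h
      exact (hn m (not_lt.1 h)).false j
    exact RelCWComplex.skeletonLT_mono (by exact_mod_cast hm)
      (RelCWComplex.closedCell_subset_skeletonLT m j hj)
  rw [huniv] at hs
  exact ⟨s, continuousOn_univ.1 hs, hsp⟩

end CW

/-! ### Trivial vector bundles -/

section Trivial

variable {B F : Type*} [TopologicalSpace B] [NormedAddCommGroup F] [NormedSpace ℝ F]
  [FiniteDimensional ℝ F] {E : B → Type*} [∀ b, AddCommGroup (E b)] [∀ b, Module ℝ (E b)]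
  [∀ b, TopologicalSpace (E b)] [TopologicalSpace (TotalSpace F E)] [FiberBundle F E]
  [VectorBundle ℝ F E]

/-- A continuous family of linear isomorphisms from `F` to the fibers has a continuous inverse. -/
theorem continuous_symm_of_continuous_family (φ : ∀ b, F ≃ₗ[ℝ] E b)
    (hφ : Continuous fun p : B × F => (⟨p.1, φ p.1 p.2⟩ : TotalSpace F E)) :
    Continuous fun z : TotalSpace F E => (φ z.1).symm z.2 := by
  refine continuous_iff_continuousAt.2 fun z₀ => ?_
  let e := trivializationAt F E z₀.1
  have hz₀ : z₀.1 ∈ e.baseSet := mem_baseSet_trivializationAt F E z₀.1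
  let L : B → F →L[ℝ] F := fun b =>
    LinearMap.toContinuousLinearMap (e.linearMapAt ℝ b ∘ₗ (φ b : F →ₗ[ℝ] E b))
  have hLe (b : B) (hb : b ∈ e.baseSet) (v : F) : L b v = (e ⟨b, φ b v⟩).2 :=
    congrFun (e.coe_linearMapAt_of_mem hb) _
  -- In finite dimension pointwise continuity of operators is norm continuity, and inversion is
  -- continuous at invertible operators.
  have hL : ContinuousOn L e.baseSet := continuousOn_clm_apply.2 fun v => by
    have h1 : ContinuousOn (fun b => (e ⟨b, φ b v⟩).2) e.baseSet :=
      continuous_snd.comp_continuousOn (e.continuousOn.comp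
        (hφ.comp (Continuous.prodMk_left v)).continuousOn fun b hb => e.mem_source.2 hb)
    exact h1.congr fun b hb => hLe b hb v
  let L' (b : B) (hb : b ∈ e.baseSet) : F ≃L[ℝ] F :=
    ((φ b).trans (e.linearEquivAt ℝ b hb)).toContinuousLinearEquiv
  have hL' (b : B) (hb : b ∈ e.baseSet) : L b = L' b hb := by
    ext v
    rw [hLe b hb]
    rfl
  have hinv : ContinuousAt (fun b => (L b).inverse) z₀.1 := by
    have h1 : ContinuousAt ContinuousLinearMap.inverse (L z₀.1) := by
      rw [hL' _ hz₀]
      exact (contDiffAt_map_inverse (n := 0) (L' _ hz₀)).continuousAt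
    exact h1.comp (f := L) (hL.continuousAt (e.open_baseSet.mem_nhds hz₀))
  have hev : (fun z : TotalSpace F E => (φ z.1).symm z.2) =ᶠ[nhds z₀]
      fun z => (L z.1).inverse (e z).2 := by
    filter_upwards [e.open_source.mem_nhds (e.mem_source.2 hz₀)] with z hz
    have hzb := e.mem_source.1 hz
    rw [hL' z.1 hzb, ContinuousLinearMap.inverse_equiv, ContinuousLinearEquiv.coe_coe,
      ContinuousLinearEquiv.eq_symm_apply]
    change e.linearEquivAt ℝ z.1 hzb (φ z.1 ((φ z.1).symm z.2)) = _
    rw [LinearEquiv.apply_symm_apply]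
    rfl
  refine ContinuousAt.congr ?_ hev.symm
  exact (hinv.comp (f := TotalSpace.proj) (FiberBundle.continuous_proj F E).continuousAt).clm_apply
    (continuous_snd.continuousAt.comp (e.continuousOn.continuousAt
      (e.open_source.mem_nhds (e.mem_source.2 hz₀))))

/-- A vector bundle with a continuous family of linear isomorphisms from the model fiber to its
fibers is trivial. -/
theorem isTrivialVectorBundle_of_continuous_family (φ : ∀ b, F ≃ₗ[ℝ] E b)
    (hφ : Continuous fun p : B × F => (⟨p.1, φ p.1 p.2⟩ : TotalSpace F E)) :
    IsTrivialVectorBundle F E := by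
  let e : Trivialization F (π F E) :=
    { toFun := fun z => (z.1, (φ z.1).symm z.2)
      invFun := fun p => ⟨p.1, φ p.1 p.2⟩
      source := univ
      target := univ
      map_source' := fun _ _ => trivial
      map_target' := fun _ _ => trivial
      left_inv' := fun z _ => by simp
      right_inv' := fun p _ => by simp
      open_source := isOpen_univ
      open_target := isOpen_univ
      continuousOn_toFun := ((FiberBundle.continuous_proj F E).prodMk
        (continuous_symm_of_continuous_family φ hφ)).continuousOn
      continuousOn_invFun := hφ.continuousOn
      baseSet := univ
      open_baseSet := isOpen_univ
      source_eq := rfl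
      target_eq := univ_prod_univ.symm
      proj_toFun := fun _ _ => rfl }
  exact ⟨e, ⟨fun b _ => (φ b).symm.isLinear⟩, rfl⟩

end Trivial

/-! ### Rotations by unit quaternions -/

/-- The imaginary part of a quaternion as a vector of `ℝ³`. -/
def imVector : ℍ[ℝ] →ₗ[ℝ] EuclideanSpace ℝ (Fin 3) where
  toFun q := !₂[q.imI, q.imJ, q.imK]
  map_add' p q := by ext i; fin_cases i <;> simp
  map_smul' c q := by ext i; fin_cases i <;> simp

theorem imQuaternion_imVector {q : ℍ[ℝ]} (hq : star q = -q) : imQuaternion (imVector q) = q :=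
  QuaternionAlgebra.ext (Quaternion.star_eq_neg.1 hq).symm rfl rfl rfl

theorem star_imQuaternion (v : EuclideanSpace ℝ (Fin 3)) :
    star (imQuaternion v) = -imQuaternion v :=
  Quaternion.star_eq_neg.2 rfl

/-- The rotation `v ↦ q v q⁻¹` of `ℝ³` given by a unit quaternion. -/
def quaternionRotation (q : Metric.sphere (0 : ℍ[ℝ]) 1) :
    EuclideanSpace ℝ (Fin 3) →ₗ[ℝ] EuclideanSpace ℝ (Fin 3) :=
  imVector ∘ₗ LinearMap.mulRight ℝ (star (q : ℍ[ℝ])) ∘ₗ LinearMap.mulLeft ℝ (q : ℍ[ℝ]) ∘ₗ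
    imQuaternion

theorem imQuaternion_quaternionRotation (q : Metric.sphere (0 : ℍ[ℝ]) 1)
    (v : EuclideanSpace ℝ (Fin 3)) :
    imQuaternion (quaternionRotation q v) = q * imQuaternion v * star (q : ℍ[ℝ]) :=
  imQuaternion_imVector (by simp [star_mul, star_imQuaternion, mul_assoc])

theorem quaternionRotation_mul (p q : Metric.sphere (0 : ℍ[ℝ]) 1) (v : EuclideanSpace ℝ (Fin 3)) :
    quaternionRotation (p * q) v = quaternionRotation p (quaternionRotation q v) := by
  apply imQuaternion_injective
  simp [imQuaternion_quaternionRotation, mul_assoc]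

theorem quaternionRotation_one (v : EuclideanSpace ℝ (Fin 3)) : quaternionRotation 1 v = v := by
  apply imQuaternion_injective
  simp [imQuaternion_quaternionRotation]

theorem continuous_quaternionRotation : Continuous fun p : Metric.sphere (0 : ℍ[ℝ]) 1 ×
    EuclideanSpace ℝ (Fin 3) => quaternionRotation p.1 p.2 := by
  have h1 : Continuous imVector := imVector.continuous_of_finiteDimensional
  have h2 : Continuous imQuaternion := imQuaternion.continuous_of_finiteDimensional
  change Continuous fun p : Metric.sphere (0 : ℍ[ℝ]) 1 × EuclideanSpace ℝ (Fin 3) =>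
    imVector (p.1 * imQuaternion p.2 * star (p.1 : ℍ[ℝ]))
  fun_prop

/-- The rotation by a unit quaternion as a linear equivalence. -/
def quaternionRotationEquiv (q : Metric.sphere (0 : ℍ[ℝ]) 1) :
    EuclideanSpace ℝ (Fin 3) ≃ₗ[ℝ] EuclideanSpace ℝ (Fin 3) :=
  LinearEquiv.ofLinearMap (quaternionRotation q) (quaternionRotation q⁻¹)
    (LinearMap.ext fun v => by simp [← quaternionRotation_mul, quaternionRotation_one])
    (LinearMap.ext fun v => by simp [← quaternionRotation_mul, quaternionRotation_one])

/-! ### The principal bundle of a spin structure -/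

namespace SpinStructure

universe u v

variable {B : Type u} [TopologicalSpace B] {E : B → Type v} [∀ b, AddCommGroup (E b)]
  [∀ b, Module ℝ (E b)] [TopologicalSpace (TotalSpace (EuclideanSpace ℝ (Fin 3)) E)]
  (σ : SpinStructure 3 E)

/-- The transition functions of a spin structure on a rank 3 bundle, as unit quaternions. -/
def transition (i j : σ.index) (b : B) : Metric.sphere (0 : ℍ[ℝ]) 1 :=
  SpinThree.unitQuaternion (σ.lift i j b)

theorem transition_mul {i j k : σ.index} {b : B} (hi : b ∈ (σ.chart i).baseSet)
    (hj : b ∈ (σ.chart j).baseSet) (hk : b ∈ (σ.chart k).baseSet) :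
    σ.transition i j b * σ.transition j k b = σ.transition i k b := by
  rw [transition, transition, ← SpinThree.unitQuaternion_mul, σ.cocycle i j k b ⟨⟨hi, hj⟩, hk⟩]
  rfl

theorem transition_self {i : σ.index} {b : B} (hi : b ∈ (σ.chart i).baseSet) :
    σ.transition i i b = 1 :=
  mul_eq_left.1 (σ.transition_mul hi hi hi)

theorem chart_eq_quaternionRotation {i j : σ.index} {b : B} (hi : b ∈ (σ.chart i).baseSet)
    (hj : b ∈ (σ.chart j).baseSet) (x : E b) :
    (σ.chart i ⟨b, x⟩).2 = quaternionRotation (σ.transition i j b) (σ.chart j ⟨b, x⟩).2 := by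
  apply imQuaternion_injective
  rw [imQuaternion_quaternionRotation]
  exact SpinThree.imQuaternion_of_conj (σ.lift_spec i j b ⟨hi, hj⟩ x)

/-- The principal bundle of a spin structure on a rank 3 bundle. -/
def principalBundle : FiberBundleCore σ.index B (Metric.sphere (0 : ℍ[ℝ]) 1) where
  baseSet i := (σ.chart i).baseSet
  isOpen_baseSet i := (σ.chart i).open_baseSet
  indexAt b := (σ.covers b).choose
  mem_baseSet_at b := (σ.covers b).choose_spec
  -- `transition i j` takes chart j coordinates to chart i coordinates. With right multiplication, a
  -- section satisfies h j = h i * transition i j, so the rotation by h i composed with chart i does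
  -- not depend on i.
  coordChange i j b g := g * σ.transition i j b
  coordChange_self i b hb g := by rw [σ.transition_self hb, mul_one]
  continuousOn_coordChange i j :=
    continuous_snd.continuousOn.mul ((SpinThree.continuous_unitQuaternion.comp_continuousOn
      (σ.continuousOn_lift i j)).comp continuous_fst.continuousOn fun p hp => hp.1)
  coordChange_comp i j k b hb g := by
    rw [mul_assoc, σ.transition_mul hb.1.1 hb.1.2 hb.2]

/-- A rank 3 bundle with a spin structure whose principal bundle has a section is trivial. -/
theorem isTrivialVectorBundle_of_section [∀ b, TopologicalSpace (E b)]
    [FiberBundle (EuclideanSpace ℝ (Fin 3)) E] [VectorBundle ℝ (EuclideanSpace ℝ (Fin 3)) E]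
    {s : B → σ.principalBundle.TotalSpace} (hs : Continuous s) (hsp : ∀ b, (s b).proj = b) :
    IsTrivialVectorBundle (EuclideanSpace ℝ (Fin 3)) E := by
  have := σ.isLinear
  let Z := σ.principalBundle
  let h (i : σ.index) (b : B) : Metric.sphere (0 : ℍ[ℝ]) 1 := (Z.localTriv i (s b)).2
  have hcont (i : σ.index) : ContinuousOn (h i) (σ.chart i).baseSet :=
    continuous_snd.comp_continuousOn ((Z.localTriv i).continuousOn.comp hs.continuousOn
      fun b hb => (Z.localTriv i).mem_source.2 <| by
        change (s b).proj ∈ (σ.chart i).baseSet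
        rwa [hsp b])
  have hmul {i j : σ.index} {b : B} (hi : b ∈ (σ.chart i).baseSet)
      (hj : b ∈ (σ.chart j).baseSet) : h j b = h i b * σ.transition i j b := by
    have key (z : Z.TotalSpace) (hi : z.1 ∈ (σ.chart i).baseSet)
        (hj : z.1 ∈ (σ.chart j).baseSet) :
        (Z.localTriv j z).2 = (Z.localTriv i z).2 * σ.transition i j z.1 :=
      (Z.coordChange_comp (Z.indexAt z.1) i j z.1 ⟨⟨Z.mem_baseSet_at _, hi⟩, hj⟩ z.2).symm
    have := key (s b) (by rwa [hsp b]) (by rwa [hsp b])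
    rwa [hsp b] at this
  -- The inverse of that chart-independent isomorphism, written in a preferred chart; `hφ` reads it
  -- in every chart.
  let φ (b : B) : EuclideanSpace ℝ (Fin 3) ≃ₗ[ℝ] E b :=
    (((σ.chart (Z.indexAt b)).linearEquivAt ℝ b (Z.mem_baseSet_at b)).trans
      (quaternionRotationEquiv (h (Z.indexAt b) b))).symm
  have hφ {i : σ.index} {b : B} (hi : b ∈ (σ.chart i).baseSet) (v : EuclideanSpace ℝ (Fin 3)) :
      (σ.chart i ⟨b, φ b v⟩).2 = quaternionRotation (h i b)⁻¹ v := by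
    have hb : b ∈ (σ.chart (Z.indexAt b)).baseSet := Z.mem_baseSet_at b
    have h1 : (σ.chart (Z.indexAt b) ⟨b, φ b v⟩).2 = quaternionRotation (h (Z.indexAt b) b)⁻¹ v :=
      ((σ.chart (Z.indexAt b)).linearEquivAt ℝ b hb).apply_symm_apply _
    rw [σ.chart_eq_quaternionRotation hi hb, h1, ← quaternionRotation_mul, hmul hi hb, mul_inv_rev,
      mul_inv_cancel_left]
  refine isTrivialVectorBundle_of_continuous_family φ (continuous_iff_continuousAt.2 fun p => ?_)
  obtain ⟨i, hi⟩ := σ.covers p.1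
  have hnhds : (σ.chart i).baseSet ×ˢ univ ∈ nhds p :=
    ((σ.chart i).open_baseSet.prod isOpen_univ).mem_nhds ⟨hi, trivial⟩
  refine (σ.chart i).continuousAt_of_comp_left continuous_fst.continuousAt hi ?_
  refine ContinuousAt.congr (f := fun p => (p.1, quaternionRotation (h i p.1)⁻¹ p.2)) ?_ ?_
  · refine continuous_fst.continuousAt.prodMk (continuous_quaternionRotation.continuousAt.comp
      (f := fun p : B × EuclideanSpace ℝ (Fin 3) => ((h i p.1)⁻¹, p.2)) ?_)
    refine ContinuousAt.prodMk (ContinuousAt.inv ?_) continuous_snd.continuousAt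
    exact ((hcont i).continuousAt ((σ.chart i).open_baseSet.mem_nhds hi)).comp
      continuous_fst.continuousAt
  · filter_upwards [hnhds] with p hp
    exact Prod.ext (show p.1 = (σ.chart i ⟨p.1, φ p.1 p.2⟩).1 from
      ((σ.chart i).coe_fst' (x := ⟨p.1, φ p.1 p.2⟩) hp.1).symm) (hφ hp.1 p.2).symm

/-- A rank 3 bundle with a spin structure over a CW complex of dimension at most 3 is trivial. -/
theorem isTrivialVectorBundle (σ : SpinStructure 3 E) [T2Space B]
    [Topology.CWComplex (univ : Set B)]
    (hB : ∀ n : ℕ, 3 < n → IsEmpty (Topology.RelCWComplex.cell (univ : Set B) n))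
    [∀ b, TopologicalSpace (E b)]
    [FiberBundle (EuclideanSpace ℝ (Fin 3)) E] [VectorBundle ℝ (EuclideanSpace ℝ (Fin 3)) E] :
    IsTrivialVectorBundle (EuclideanSpace ℝ (Fin 3)) E := by
  -- The dimension bound there is strict, hence 4.
  obtain ⟨s, hs, hsp⟩ := exists_continuous_section (B := B) (E := σ.principalBundle.Fiber) 4
    (fun k hk => hB k hk) fun k hk => isExtensorFor_unitQuaternion (Nat.lt_succ_iff.1 hk)
  exact σ.isTrivialVectorBundle_of_section hs hsp

end SpinStructure

/-! ### Parallelizability from a global family of local charts -/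

/-- A manifold is parallelizable if there is a smooth family of maps `f x : ℝⁿ → M` with `f x 0 = x`
that are immersions at `0`. -/
theorem parallelizable_of_family {n : ℕ} {M : Type*} [TopologicalSpace M]
    [ChartedSpace (EuclideanSpace ℝ (Fin n)) M] [IsManifold (𝓡 n) ∞ M]
    (f : M → EuclideanSpace ℝ (Fin n) → M)
    (hf : ∀ x, ContMDiffAt ((𝓡 n).prod (𝓡 n)) (𝓡 n) ∞ (Function.uncurry f) (x, 0))
    (hf0 : ∀ x, f x 0 = x)
    (hinj : ∀ x, Function.Injective (mfderiv (𝓡 n) (𝓡 n) (f x) 0)) :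
    Parallelizable n M := by
  have : IsManifold (𝓡 n) 1 M := IsManifold.of_le (n := ∞) (by simp)
  let V := EuclideanSpace ℝ (Fin n)
  -- All tangent spaces are `V` by definition, so the differentials at 0 become endomorphisms of
  -- `V`; their continuity is meant in tangent coordinates.
  obtain ⟨D, hDc, hDi⟩ : ∃ D : M → V →L[ℝ] V, (∀ x₀, ContinuousAt
      (inTangentCoordinates (𝓡 n) (𝓡 n) (fun _ : M => (0 : V)) (fun x => f x 0) D x₀) x₀) ∧
      ∀ x, Function.Injective (D x) :=
    ⟨fun x => mfderiv (𝓡 n) (𝓡 n) (f x) 0, fun x₀ =>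
      ((hf x₀).mfderiv f (fun _ => 0) (m := 0) contMDiffAt_const (by simp)).continuousAt, hinj⟩
  let φ (x : M) : V ≃ₗ[ℝ] TangentSpace (𝓡 n) x :=
    LinearEquiv.ofInjectiveEndo (D x).toLinearMap (hDi x)
  refine isTrivialVectorBundle_of_continuous_family φ (continuous_iff_continuousAt.2 fun p => ?_)
  refine (FiberBundle.continuousAt_totalSpace _ _).2 ⟨continuous_fst.continuousAt, ?_⟩
  refine (((hDc p.1).comp (f := Prod.fst) (x := p) continuous_fst.continuousAt).clm_apply
    continuous_snd.continuousAt).congr ?_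
  have hmem : ∀ᶠ q : M × V in nhds p, q.1 ∈ (chartAt V p.1).source :=
    continuous_fst.continuousAt.eventually_mem (chart_source_mem_nhds _ _)
  filter_upwards [hmem] with q hq
  rw [Function.comp_apply, inTangentCoordinates_eq _ _ _ (by simp) (by rw [hf0, hf0]; exact hq),
    TangentBundle.coordChange_model_space]
  simp only [hf0]
  rfl

theorem injective_mfderiv_of_leftInverse {E H M E' H' M' : Type*} [NormedAddCommGroup E]
    [NormedSpace ℝ E] [TopologicalSpace H] {I : ModelWithCorners ℝ E H} [TopologicalSpace M]
    [ChartedSpace H M] [NormedAddCommGroup E'] [NormedSpace ℝ E'] [TopologicalSpace H']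
    {I' : ModelWithCorners ℝ E' H'} [TopologicalSpace M'] [ChartedSpace H' M'] {f : M → M'}
    {g : M' → M} {x : M} (hf : MDifferentiableAt I I' f x) (hg : MDifferentiableAt I' I g (f x))
    (hgf : g ∘ f =ᶠ[nhds x] id) : Function.Injective (mfderiv I I' f x) := by
  have h : ((mfderiv I' I g (f x)).comp (mfderiv I I' f x) : E →L[ℝ] E) =
      ContinuousLinearMap.id ℝ E := by
    have h1 := mfderiv_comp x hg hf
    rw [hgf.mfderiv_eq, mfderiv_id] at h1
    exact h1.symm
  intro v w hvw
  have h1 := congrArg (mfderiv I' I g (f x)) hvw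
  exact (DFunLike.congr_fun h v).symm.trans (h1.trans (DFunLike.congr_fun h w))

/-! ### Tangent frames of the 3-sphere -/

namespace ThreeSphere

/-- The tangent vector at `z ∈ S³` with coordinates `v` in the frame `(z * i, z * j, z * k)`, for
the quaternionic structure `z = z₀ + z₁ j` of `ℂ²`. -/
def frame (v : EuclideanSpace ℝ (Fin 3)) (z : EuclideanSpace ℂ (Fin 2)) :
    EuclideanSpace ℂ (Fin 2) :=
  !₂[Complex.I * v 0 * z 0 + (-v 1 + Complex.I * v 2) * z 1,
    (v 1 + Complex.I * v 2) * z 0 - Complex.I * v 0 * z 1]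

/-- Left multiplication by complex numbers commutes with right multiplication by quaternions; this
is what lets the frame descend. -/
theorem frame_smul (v : EuclideanSpace ℝ (Fin 3)) (c : ℂ) (z : EuclideanSpace ℂ (Fin 2)) :
    frame v (c • z) = c • frame v z := by
  ext i; fin_cases i <;> simp [frame] <;> ring

theorem frame_zero (z : EuclideanSpace ℂ (Fin 2)) : frame 0 z = 0 := by
  ext i; fin_cases i <;> simp [frame]

theorem contDiff_frame : ContDiff ℝ ∞
    fun p : EuclideanSpace ℂ (Fin 2) × EuclideanSpace ℝ (Fin 3) => frame p.2 p.1 := by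
  have hz (i : Fin 2) : ContDiff ℝ ∞
      fun p : EuclideanSpace ℂ (Fin 2) × EuclideanSpace ℝ (Fin 3) => p.1 i :=
    ((EuclideanSpace.proj i : EuclideanSpace ℂ (Fin 2) →L[ℂ] ℂ).restrictScalars ℝ).contDiff.comp
      contDiff_fst
  have hv (i : Fin 3) : ContDiff ℝ ∞
      fun p : EuclideanSpace ℂ (Fin 2) × EuclideanSpace ℝ (Fin 3) => (p.2 i : ℂ) :=
    Complex.ofRealCLM.contDiff.comp ((EuclideanSpace.proj i : _ →L[ℝ] ℝ).contDiff.comp contDiff_snd)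
  refine (contDiff_piLp 2).2 fun i => ?_
  fin_cases i
  · exact ((contDiff_const.mul (hv 0)).mul (hz 0)).add
      (((hv 1).neg.add (contDiff_const.mul (hv 2))).mul (hz 1))
  · exact (((hv 1).add (contDiff_const.mul (hv 2))).mul (hz 0)).sub
      ((contDiff_const.mul (hv 0)).mul (hz 1))

/-- The real inner product of `ℂ²`, in coordinates, as a linear form. -/
def dot (w : EuclideanSpace ℂ (Fin 2)) : EuclideanSpace ℂ (Fin 2) →ₗ[ℝ] ℝ where
  toFun z := (w 0).re * (z 0).re + (w 0).im * (z 0).im + (w 1).re * (z 1).re + (w 1).im * (z 1).im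
  map_add' x y := by simp; ring
  map_smul' c x := by simp; ring

theorem dot_self (z : ThreeSphere) : dot z z = 1 := by
  have h : ‖(z : EuclideanSpace ℂ (Fin 2))‖ ^ 2 = 1 := by simp [norm_eq_of_mem_sphere z]
  rw [EuclideanSpace.norm_sq_eq, Fin.sum_univ_two, ← Complex.normSq_eq_norm_sq,
    ← Complex.normSq_eq_norm_sq, Complex.normSq_apply, Complex.normSq_apply] at h
  simp only [dot, LinearMap.coe_mk, AddHom.coe_mk]
  linarith

theorem dot_frame (v : EuclideanSpace ℝ (Fin 3)) (z : EuclideanSpace ℂ (Fin 2)) :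
    dot z (frame v z) = 0 := by
  simp [dot, frame]; ring

theorem dot_frame_self (v : EuclideanSpace ℝ (Fin 3)) (z : EuclideanSpace ℂ (Fin 2)) :
    dot (frame v z) z = 0 := by
  simp [dot, frame]; ring

/-- z·i, z·j, z·k are orthogonal of length ‖z‖, so inner products recover the coordinates. -/
theorem dot_frame_frame (a : Fin 3) (v : EuclideanSpace ℝ (Fin 3))
    (z : EuclideanSpace ℂ (Fin 2)) :
    dot (frame (EuclideanSpace.single a 1) z) (frame v z) = v a * dot z z := by
  fin_cases a <;> simp [dot, frame] <;> ring

theorem add_frame_ne_zero (z : ThreeSphere) (v : EuclideanSpace ℝ (Fin 3)) :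
    (z : EuclideanSpace ℂ (Fin 2)) + frame v z ≠ 0 := by
  intro h
  have h1 := congrArg (dot z) h
  rw [map_add, dot_frame, dot_self, map_zero] at h1
  norm_num at h1

/-- The central projection to `S³` of the point of the tangent space at `z ∈ S³` with the
coordinates `v`. -/
def translate (z : ThreeSphere) (v : EuclideanSpace ℝ (Fin 3)) : ThreeSphere :=
  ⟨(‖(z : EuclideanSpace ℂ (Fin 2)) + frame v z‖⁻¹ : ℝ) •
    ((z : EuclideanSpace ℂ (Fin 2)) + frame v z), mem_sphere_zero_iff_norm.2
      (norm_smul_inv_norm (𝕜 := ℝ) (add_frame_ne_zero z v))⟩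

theorem translate_zero (z : ThreeSphere) : translate z 0 = z := by
  ext1
  simp [translate, frame_zero, norm_eq_of_mem_sphere z]

theorem translate_smul (t : ℕ) [NeZero t] (ζ : rootsOfUnity t ℂ) (z : ThreeSphere)
    (v : EuclideanSpace ℝ (Fin 3)) : translate (ζ • z) v = ζ • translate z v := by
  ext1
  rw [coe_smul]
  simp only [translate, coe_smul, frame_smul, ← smul_add, norm_smul,
    Complex.norm_eq_one_of_mem_rootsOfUnity ζ.2, one_mul]
  rw [smul_comm]

theorem contMDiff_translate : ContMDiff ((𝓡 3).prod (𝓡 3)) (𝓡 3) ∞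
    fun p : ThreeSphere × EuclideanSpace ℝ (Fin 3) => translate p.1 p.2 := by
  have h1 : ContMDiff ((𝓡 3).prod (𝓡 3))
      𝓘(ℝ, EuclideanSpace ℂ (Fin 2) × EuclideanSpace ℝ (Fin 3)) ∞
      fun p : ThreeSphere × EuclideanSpace ℝ (Fin 3) =>
        ((p.1 : EuclideanSpace ℂ (Fin 2)), p.2) :=
    (contMDiff_coe_sphere.comp contMDiff_fst).prodMk_space contMDiff_snd
  have h2 : ContMDiff ((𝓡 3).prod (𝓡 3)) 𝓘(ℝ, EuclideanSpace ℂ (Fin 2)) ∞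
      fun p : ThreeSphere × EuclideanSpace ℝ (Fin 3) =>
        ((translate p.1 p.2 : ThreeSphere) : EuclideanSpace ℂ (Fin 2)) := by
    intro p
    have h3 : ContDiffAt ℝ ∞ (fun q : EuclideanSpace ℂ (Fin 2) × EuclideanSpace ℝ (Fin 3) =>
        (‖q.1 + frame q.2 q.1‖⁻¹ : ℝ) • (q.1 + frame q.2 q.1)) (p.1, p.2) := by
      have h4 := (contDiff_fst.add contDiff_frame).contDiffAt (x := (p.1.1, p.2))
      exact ((h4.norm ℝ (add_frame_ne_zero p.1 p.2)).inv
        (norm_ne_zero_iff.2 (add_frame_ne_zero p.1 p.2))).smul h4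
    have h5 := ContMDiffAt.comp p h3.contMDiffAt (h1 p)
    exact h5
  exact h2.codRestrict_sphere fun p => (translate p.1 p.2).2

/-- A smooth left inverse of `translate z`, defined near `z`. -/
def coordinates (z : ThreeSphere) (y : EuclideanSpace ℂ (Fin 2)) : EuclideanSpace ℝ (Fin 3) :=
  WithLp.toLp 2 fun a => dot (frame (EuclideanSpace.single a 1) z) y / dot z y

/-- The quotient in `coordinates` cancels the normalizing factor of `translate`. -/
theorem coordinates_translate (z : ThreeSphere) (v : EuclideanSpace ℝ (Fin 3)) :
    coordinates z (translate z v) = v := by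
  ext a
  have h := norm_ne_zero_iff.2 (add_frame_ne_zero z v)
  simp only [coordinates, translate, map_smul, map_add, dot_frame, dot_frame_self,
    dot_frame_frame, dot_self, zero_add, add_zero, mul_one, smul_eq_mul]
  field_simp

theorem contDiffAt_coordinates (z : ThreeSphere) :
    ContDiffAt ℝ ∞ (coordinates z) (z : EuclideanSpace ℂ (Fin 2)) := by
  have hdot (w : EuclideanSpace ℂ (Fin 2)) : ContDiff ℝ ∞ (dot w) :=
    (LinearMap.toContinuousLinearMap (dot w)).contDiff
  refine (contDiffAt_piLp 2).2 fun a => ?_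
  exact (hdot _).contDiffAt.div (hdot _).contDiffAt (by rw [dot_self]; exact one_ne_zero)

end ThreeSphere

/-! ### Lens spaces are parallelizable -/

namespace LensSpace

variable (t : ℕ) [NeZero t]

/-- The projection to a lens space is a local diffeomorphism. -/
theorem exists_smooth_local_inverse (z : ThreeSphere) :
    ∃ e : OpenPartialHomeomorph ThreeSphere (LensSpace t), proj t = e ∧ z ∈ e.source ∧
      ContMDiffAt (𝓡 3) (𝓡 3) ∞ (proj t) z ∧ ContMDiffAt (𝓡 3) (𝓡 3) ∞ e.symm (proj t z) := by
  obtain ⟨e, hz, he⟩ := proj_isLocalHomeomorph t z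
  let φ := chartAt (EuclideanSpace ℝ (Fin 3)) z
  let c : OpenPartialHomeomorph (LensSpace t) (EuclideanSpace ℝ (Fin 3)) := e.symm.trans φ
  have hc : c ∈ IsManifold.maximalAtlas (𝓡 3) ∞ (LensSpace t) :=
    IsManifold.subset_maximalAtlas ⟨e, he, φ, chart_mem_atlas _ z, rfl⟩
  have hzφ : z ∈ φ.source := mem_chart_source _ z
  have hez : e.symm (proj t z) = z := by rw [he]; exact e.left_inv hz
  have hzc : proj t z ∈ c.source := by
    simp only [c, OpenPartialHomeomorph.trans_source, OpenPartialHomeomorph.symm_source]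
    refine ⟨he ▸ e.map_source hz, ?_⟩
    rw [mem_preimage, hez]
    exact hzφ
  have hcz : c (proj t z) = φ z := by
    simp [c, hez]
  refine ⟨e, he, hz, ?_, ?_⟩
  -- In the charts `φ` and `c` the projection is the identity.
  · have h1 : ContMDiffAt (𝓡 3) (𝓡 3) ∞ (c.symm ∘ φ) z := by
      refine ContMDiffAt.comp z ?_ (contMDiffAt_of_mem_maximalAtlas
        (IsManifold.chart_mem_maximalAtlas z) hzφ)
      exact contMDiffAt_symm_of_mem_maximalAtlas hc (hcz ▸ c.map_source hzc)
    refine h1.congr_of_eventuallyEq ?_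
    filter_upwards [φ.open_source.mem_nhds hzφ] with y hy
    simp [c, he, φ.left_inv hy]
  · have h1 : ContMDiffAt (𝓡 3) (𝓡 3) ∞ (φ.symm ∘ c) (proj t z) := by
      refine ContMDiffAt.comp _ ?_ (contMDiffAt_of_mem_maximalAtlas hc hzc)
      rw [hcz]
      exact contMDiffAt_symm_of_mem_maximalAtlas (IsManifold.chart_mem_maximalAtlas z)
        (φ.map_source hzφ)
    refine h1.congr_of_eventuallyEq ?_
    filter_upwards [c.open_source.mem_nhds hzc] with y hy
    simp only [c, OpenPartialHomeomorph.trans_source] at hy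
    simp [c, φ.left_inv hy.2]

/-- The map of lens spaces induced by `ThreeSphere.translate`. -/
def translate (q : LensSpace t) (v : EuclideanSpace ℝ (Fin 3)) : LensSpace t :=
  Quotient.liftOn q (fun z => proj t (z.translate v)) fun x y hxy => by
    obtain ⟨ζ, rfl⟩ := hxy
    exact (proj_eq_iff t).2 ⟨ζ, (ThreeSphere.translate_smul t ζ y v).symm⟩

theorem translate_proj (z : ThreeSphere) (v : EuclideanSpace ℝ (Fin 3)) :
    translate t (proj t z) v = proj t (z.translate v) := rfl

theorem parallelizable : Parallelizable 3 (LensSpace t) := by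
  have hsmooth (q : LensSpace t) : ContMDiffAt ((𝓡 3).prod (𝓡 3)) (𝓡 3) ∞
      (Function.uncurry (translate t)) (q, 0) := by
    obtain ⟨z, rfl⟩ := proj_surjective t q
    obtain ⟨e, he, hz, hproj, hsymm⟩ := exists_smooth_local_inverse t z
    have hez : e.symm (proj t z) = z := by rw [he]; exact e.left_inv hz
    -- Near `proj t z` the map is computed upstairs through the local section `e.symm`.
    have h1 : ContMDiffAt ((𝓡 3).prod (𝓡 3)) (𝓡 3) ∞
        (fun p : LensSpace t × EuclideanSpace ℝ (Fin 3) =>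
          proj t ((e.symm p.1).translate p.2)) (proj t z, 0) := by
      have h2 : ContMDiffAt ((𝓡 3).prod (𝓡 3)) ((𝓡 3).prod (𝓡 3)) ∞
          (fun p : LensSpace t × EuclideanSpace ℝ (Fin 3) => (e.symm p.1, p.2)) (proj t z, 0) :=
        (hsymm.comp (proj t z, (0 : EuclideanSpace ℝ (Fin 3))) contMDiffAt_fst).prodMk
          contMDiffAt_snd
      have h3 := ContMDiffAt.comp (proj t z, (0 : EuclideanSpace ℝ (Fin 3)))
        (g := fun p : ThreeSphere × EuclideanSpace ℝ (Fin 3) => p.1.translate p.2)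
        (ThreeSphere.contMDiff_translate _) h2
      refine ContMDiffAt.comp (proj t z, (0 : EuclideanSpace ℝ (Fin 3))) ?_ h3
      simp only [hez, ThreeSphere.translate_zero]
      exact hproj
    refine h1.congr_of_eventuallyEq ?_
    have hmem : proj t z ∈ e.target := he ▸ e.map_source hz
    filter_upwards [continuous_fst.continuousAt.eventually_mem (x := (proj t z, _))
      (e.open_target.mem_nhds hmem)] with p hp
    have h4 : p.1 = proj t (e.symm p.1) := by rw [he]; exact (e.right_inv hp).symm
    change translate t p.1 p.2 = _
    conv_lhs => rw [h4]
    rfl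
  have hzero (q : LensSpace t) : translate t q 0 = q := by
    obtain ⟨z, rfl⟩ := proj_surjective t q
    rw [translate_proj, ThreeSphere.translate_zero]
  refine parallelizable_of_family (translate t) hsmooth hzero fun q => ?_
  obtain ⟨z, rfl⟩ := proj_surjective t q
  obtain ⟨e, he, hz, -, hsymm⟩ := exists_smooth_local_inverse t z
  have hez : e.symm (proj t z) = z := by rw [he]; exact e.left_inv hz
  have hf : ContMDiffAt (𝓡 3) (𝓡 3) ∞ (translate t (proj t z)) 0 :=
    (hsmooth (proj t z)).comp (0 : EuclideanSpace ℝ (Fin 3))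
      (contMDiffAt_const.prodMk contMDiffAt_id)
  -- A smooth local left inverse: lift by `e.symm`, then read the coordinates at `z`.
  have hg : ContMDiffAt (𝓡 3) (𝓡 3) ∞
      (fun q => z.coordinates (e.symm q)) (translate t (proj t z) 0) := by
    rw [hzero]
    have h1 := (contMDiff_coe_sphere (e.symm (proj t z))).comp (proj t z) hsymm
    refine ContMDiffAt.comp (proj t z) (g := z.coordinates) ?_ h1
    simp only [hez]
    exact z.contDiffAt_coordinates.contMDiffAt
  refine injective_mfderiv_of_leftInverse (hf.mdifferentiableAt (by simp))
    (hg.mdifferentiableAt (by simp)) ?_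
  have hcont : ContinuousAt z.translate 0 :=
    (ThreeSphere.contMDiff_translate.continuous.comp (Continuous.prodMk_right z)).continuousAt
  filter_upwards [hcont (e.open_source.mem_nhds (by rwa [ThreeSphere.translate_zero]))] with v hv
  rw [Function.comp_apply, translate_proj, he, e.left_inv hv, ThreeSphere.coordinates_translate]
  rfl

end LensSpace

end

/-- A rank 3 real vector bundle admitting a spin structure, over a CW complex of dimension at
most 3, is trivial; and every 3-dimensional lens space is parallelizable. -/
theorem proposition5p1 :
    (∀ (B : Type*) [TopologicalSpace B] [T2Space B] [Topology.CWComplex (Set.univ : Set B)],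
      (∀ n : ℕ, 3 < n → IsEmpty (Topology.RelCWComplex.cell (Set.univ : Set B) n)) →
      ∀ (E : B → Type*) [∀ b, AddCommGroup (E b)] [∀ b, Module ℝ (E b)]
        [∀ b, TopologicalSpace (E b)]
        [TopologicalSpace (Bundle.TotalSpace (EuclideanSpace ℝ (Fin 3)) E)]
        [FiberBundle (EuclideanSpace ℝ (Fin 3)) E]
        [VectorBundle ℝ (EuclideanSpace ℝ (Fin 3)) E],
      Nonempty (SpinStructure 3 E) → IsTrivialVectorBundle (EuclideanSpace ℝ (Fin 3)) E) ∧
    (∀ (t : ℕ) [NeZero t], Parallelizable 3 (LensSpace t)) := by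
  refine ⟨?_, fun t _ => LensSpace.parallelizable t⟩
  rintro B _ _ _ hB E _ _ _ _ _ _ ⟨σ⟩
  exact σ.isTrivialVectorBundle hB
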